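/- Theorem 3.2. Conventions: for a complex Banach space $X$ and a continuous symmetric $m$-linear form $L:X^m\to\mathbb C$ put $\widehat L(x)=L(x,\dots,x)$ and $\|\widehat L\|=\sup_{\|x\|\le1}|\widehat L(x)|$. If $k_1,\dots,k_n$ are nonnegative integers with $k_1+\dots+k_n=m$, write $L(x_1^{k_1}\cdots x_n^{k_n})$ for the value of $L$ with each $x_j$ repeated $k_j$ times, and let $\mathbb C(k_1,\dots,k_n;X)$ be the infimum of all $M>0$ such that $\sup_{\|x_1\|,\dots,\|x_n\|\le1}|L(x_1^{k_1}\cdots x_n^{k_n})|\le M\|\widehat L\|$ for every continuous symmetric $m$-linear form $L:X^m\to\mathbb C$. For $1\le p\le\infty$ let $p'$ be the conjugate exponent, $1/p+1/p'=1$; likewise $m'=m/(m-1)$ if $m\ge2$, and $m'=\infty$ if $m\le1$. Also $0^0=1$ and $1/\infty=0$. Statement: Let $k_1,\dots,k_n$ be nonnegative integers whose sum is $m$, and let $1\le p\le\infty$. For every measure $\mu$ and the complex space $L^p(\mu)$, $$\mathbb C(k_1,\dots,k_n;L^p(\mu))\le\begin{cases}\left(\dfrac{m^m}{k_1^{k_1}\cdots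 k_n^{k_n}}\right)^{1/p}\dfrac{k_1!\cdots k_n!}{m!}&\text{if }1\le p\le m',\\[2ex]\left(\dfrac{m^m}{k_1^{k_1}\cdots k_n^{k_n}}\right)^{1/p'}\dfrac{k_1!\cdots k_n!}{m!}&\text{if }m\le p\le\infty.\end{cases}$$ For $1\le p\le m'$ the estimate is best possible: equality holds for the complex sequence space $\ell^p$, for all $k_1,\dots,k_n$. Moreover it is attained there: the continuous symmetric $m$-linear form $L$ on $\ell^p$ with $\widehat L(u)=u_1\cdots u_m$ satisfies $\|\widehat L\|>0$, and there are unit vectors $y_1,\dots,y_n\in\ell^p$ with $$|L(y_1^{k_1}\cdots y_n^{k_n})|=\left(\frac{m^m}{k_1^{k_1}\cdots k_n^{k_n}}\right)^{1/p}\frac{k_1!\cdots k_n!}{m!}\,\|\widehat L\|.$$ -/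

import Mathlib

open MeasureTheory
open scoped ENNReal NNReal Nat

noncomputable section

/-- The `m`-linear form `L` is symmetric. -/
def IsSymmetricForm {X : Type*} [NormedAddCommGroup X] [NormedSpace ℂ X] {m : ℕ}
    (L : ContinuousMultilinearMap ℂ (fun _ : Fin m => X) ℂ) : Prop :=
  ∀ (σ : Equiv.Perm (Fin m)) (x : Fin m → X), L (fun i => x (σ i)) = L x

/-- The `m`-homogeneous polynomial `x ↦ L (x, …, x)` associated with `L`. -/
def assocPoly {X : Type*} [NormedAddCommGroup X] [NormedSpace ℂ X] {m : ℕ}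
    (L : ContinuousMultilinearMap ℂ (fun _ : Fin m => X) ℂ) (x : X) : ℂ :=
  L (fun _ => x)

/-- The norm `sup {‖L (x, …, x)‖ : ‖x‖ ≤ 1}` of the associated polynomial. -/
def polyNorm {X : Type*} [NormedAddCommGroup X] [NormedSpace ℂ X] {m : ℕ}
    (L : ContinuousMultilinearMap ℂ (fun _ : Fin m => X) ℂ) : ℝ :=
  ⨆ x : Metric.closedBall (0 : X) 1, ‖assocPoly L (x : X)‖

/-- The value `L (x₁, …, x₁, …, xₙ, …, xₙ)`, where `xⱼ` fills `k j` consecutive arguments. -/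
def evalBlocks {X : Type*} [NormedAddCommGroup X] [NormedSpace ℂ X] {n : ℕ} (k : Fin n → ℕ)
    (L : ContinuousMultilinearMap ℂ (fun _ : Fin (∑ j, k j) => X) ℂ) (x : Fin n → X) : ℂ :=
  L (fun i => x (finSigmaFinEquiv.symm i).1)

/-- `sup ‖L (x₁, …, x₁, …, xₙ, …, xₙ)‖` over all `x₁, …, xₙ` in the closed unit ball. -/
def blockNorm {X : Type*} [NormedAddCommGroup X] [NormedSpace ℂ X] {n : ℕ} (k : Fin n → ℕ)
    (L : ContinuousMultilinearMap ℂ (fun _ : Fin (∑ j, k j) => X) ℂ) : ℝ :=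
  ⨆ x : Fin n → Metric.closedBall (0 : X) 1, ‖evalBlocks k L (fun j => (x j : X))‖

/-- The supremum in `polyNorm` is over a bounded set. -/
theorem bddAbove_polyNorm {X : Type*} [NormedAddCommGroup X] [NormedSpace ℂ X] {m : ℕ}
    (L : ContinuousMultilinearMap ℂ (fun _ : Fin m => X) ℂ) :
    BddAbove (Set.range fun x : Metric.closedBall (0 : X) 1 => ‖assocPoly L (x : X)‖) := by
  refine ⟨‖L‖, ?_⟩
  rintro _ ⟨x, rfl⟩
  have h := L.le_opNorm_mul_pow_of_le (m := fun _ => (x : X)) (b := 1)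
    ((pi_norm_le_iff_of_nonneg zero_le_one).2 fun _ => mem_closedBall_zero_iff.1 x.2)
  simpa [assocPoly] using h

/-- The supremum in `blockNorm` is over a bounded set. -/
theorem bddAbove_blockNorm {X : Type*} [NormedAddCommGroup X] [NormedSpace ℂ X] {n : ℕ}
    (k : Fin n → ℕ) (L : ContinuousMultilinearMap ℂ (fun _ : Fin (∑ j, k j) => X) ℂ) :
    BddAbove (Set.range fun x : Fin n → Metric.closedBall (0 : X) 1 =>
      ‖evalBlocks k L (fun j => (x j : X))‖) := by
  refine ⟨‖L‖, ?_⟩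
  rintro _ ⟨x, rfl⟩
  have h := L.le_opNorm_mul_pow_of_le
    (m := fun i => (x (finSigmaFinEquiv.symm i).1 : X)) (b := 1)
    ((pi_norm_le_iff_of_nonneg zero_le_one).2 fun i =>
      mem_closedBall_zero_iff.1 (x (finSigmaFinEquiv.symm i).1).2)
  simpa [evalBlocks] using h

/-- The polarization constant `ℂ(k₁, …, kₙ; X)` of a complex normed space `X`: the infimum of all
real `M > 0` with `sup ‖L (x₁, …, x₁, …, xₙ, …, xₙ)‖ ≤ M * polyNorm L` for every continuous
symmetric `m`-linear form `L` on `X`, where `m = k₁ + ⋯ + kₙ`.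
It is taken in `[0, ∞]`, so that a bound on it says in particular that such an `M` exists. -/
def polarizationConst {n : ℕ} (k : Fin n → ℕ) (X : Type*) [NormedAddCommGroup X]
    [NormedSpace ℂ X] : ℝ≥0∞ :=
  ⨅ M ∈ {M : ℝ≥0 | 0 < M ∧
    ∀ L : ContinuousMultilinearMap ℂ (fun _ : Fin (∑ j, k j) => X) ℂ,
      IsSymmetricForm L → blockNorm k L ≤ M * polyNorm L}, (M : ℝ≥0∞)

/-- The number `(m ^ m / (k₁ ^ k₁ ⋯ kₙ ^ kₙ)) ^ (1 / q) * (k₁! ⋯ kₙ!) / m!`, where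
`m = k₁ + ⋯ + kₙ`, `0 ^ 0 = 1` and `1 / ∞ = 0`. -/
def polarizationBound {n : ℕ} (k : Fin n → ℕ) (q : ℝ≥0∞) : ℝ :=
  (((∑ j, k j : ℕ) : ℝ) ^ (∑ j, k j) / ∏ j, (k j : ℝ) ^ k j) ^ (1 / q).toReal *
    ((∏ j, ((k j)! : ℝ)) / ((∑ j, k j)! : ℝ))

end

/-! Write `P` for the polynomial of `L`, and let `ω` range over a torus of `n`-tuples of roots of
unity. The value of `L` at blocks of sizes `k j` is, up to the factor `m! / ∏ (k j)!`, the Fourier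
coefficient of index `k` of `ω ↦ P (∑ ω j • y j)`. It is therefore at most the norm of `P` times the
mean of `‖∑ ω j • y j‖ ^ m`. Roots of unity of order `m + 1` already separate all exponents up to
`m`, so the torus can be finite (`sum_conj_phase_mul_assocPoly`).

If the space satisfies a type inequality with constant `1`, where means of some order `t ≥ m` of `‖∑
ω j • y j‖` are bounded by `(∑ ‖y j‖ ^ q) ^ (1 / q)`, the choice `y j = (k j) ^ (1 / q) • x j` gives
exactly the bound with exponent `1 / q` (`polarizationConst_le_of_sum_norm_rpow_le`). For scalars
this inequality is Hausdorff–Young, obtained from the three lines theorem. It lifts to `L^p` with `q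
= p'`, `t = p` if `p ≥ 2`, and with `q = p`, `t = p'` if `1 < p ≤ 2`. The condition `t ≥ m` becomes
`p ≥ m` or `p ≤ m'`. The endpoints `1` and `∞` need only the triangle inequality.

For sharpness, AM–GM bounds `u₁ ⋯ uₘ` by `m ^ (-m / p)` on the unit ball of `ℓ^p`, while flat unit
vectors on disjoint blocks make the symmetric form large. The quotient is at least the upper bound,
so both estimates are equalities (`productForm_extremal`). -/

/-! ### Counting maps with prescribed fibres -/

/-- Two maps with equally large fibres differ by a permutation of the source. -/
theorem exists_perm_comp_eq {α ι : Type*} [Fintype α] [DecidableEq ι] {f r : α → ι}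
    (h : ∀ j, Fintype.card {a // r a = j} = Fintype.card {a // f a = j}) :
    ∃ σ : Equiv.Perm α, f ∘ σ = r :=
  ⟨Equiv.ofFiberEquiv fun j => Fintype.equivOfCardEq (h j),
    funext fun a => Equiv.ofFiberEquiv_map _ a⟩

/-- The number of maps whose fibres are as large as those of `f` is a multinomial coefficient. -/
theorem card_filter_fiber_eq_mul {α ι : Type*} [Fintype α] [DecidableEq α] [Fintype ι]
    [DecidableEq ι] (f : α → ι) :
    (Finset.univ.filter fun r : α → ι =>
        ∀ j, Fintype.card {a // r a = j} = Fintype.card {a // f a = j}).card *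
      ∏ j, (Fintype.card {a // f a = j})! = (Fintype.card α)! := by
  -- Sort the permutations `σ` by `f ∘ σ`: this is orbit–stabilizer counting for the action on maps.
  rw [← Fintype.card_perm, ← Finset.card_univ,
    Finset.card_eq_sum_card_fiberwise (f := fun σ : Equiv.Perm α => f ∘ σ)
      (t := Finset.univ.filter fun r : α → ι =>
        ∀ j, Fintype.card {a // r a = j} = Fintype.card {a // f a = j})]
  · rw [Finset.sum_congr rfl, Finset.sum_const, smul_eq_mul]
    intro r hr
    obtain ⟨τ, rfl⟩ := exists_perm_comp_eq (Finset.mem_filter.1 hr).2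
    -- The permutations over `f ∘ τ` form a coset of the stabilizer of `f`, which permutes each
    -- fibre of `f` independently.
    rw [← DomMulAct.stabilizer_card f, Fintype.card_subtype]
    refine Finset.card_bij (fun σ _ => σ * τ⁻¹) ?_ ?_ ?_
    · intro σ hσ
      rw [Finset.mem_filter] at hσ ⊢
      refine ⟨Finset.mem_univ _, funext fun a => ?_⟩
      simpa using congrFun hσ.2 (τ⁻¹ a)
    · intro σ _ σ' _ h
      exact mul_right_cancel h
    · intro σ hσ
      refine ⟨σ * τ, ?_, by simp⟩
      rw [Finset.mem_filter] at hσ ⊢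
      refine ⟨Finset.mem_univ _, funext fun a => ?_⟩
      exact congrFun hσ.2 (τ a)
  · intro σ _
    simp only [Finset.coe_filter, Finset.mem_univ, true_and, Set.mem_ofPred_eq]
    intro j
    exact Fintype.card_congr (σ.subtypeEquiv fun a => Iff.rfl)

/-- The block of `{1, …, k₁ + ⋯ + kₙ}` in which an index lies. -/
def blockIndex {n : ℕ} (k : Fin n → ℕ) (i : Fin (∑ j, k j)) : Fin n :=
  (finSigmaFinEquiv.symm i).1

theorem card_blockIndex_eq {n : ℕ} (k : Fin n → ℕ) (j : Fin n) :
    Fintype.card {i // blockIndex k i = j} = k j := by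
  rw [Fintype.card_congr ((finSigmaFinEquiv.symm.subtypeEquiv fun a => Iff.rfl :
      {i // blockIndex k i = j} ≃ {s : (j : Fin n) × Fin (k j) // s.1 = j}).trans
      (Equiv.sigmaSubtype j)), Fintype.card_fin]

theorem evalBlocks_eq {X : Type*} [NormedAddCommGroup X] [NormedSpace ℂ X] {n : ℕ} (k : Fin n → ℕ)
    (L : ContinuousMultilinearMap ℂ (fun _ : Fin (∑ j, k j) => X) ℂ) (x : Fin n → X) :
    evalBlocks k L x = L (x ∘ blockIndex k) :=
  rfl

/-- A product over all indices, grouped into the fibres of `r`. -/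
theorem prod_comp_eq_prod_pow_card {α ι M : Type*} [Fintype α] [Fintype ι] [DecidableEq ι]
    [CommMonoid M] (r : α → ι) (c : ι → M) :
    ∏ a, c (r a) = ∏ j, c j ^ Fintype.card {a // r a = j} := by
  rw [← Finset.prod_fiberwise Finset.univ r]
  refine Finset.prod_congr rfl fun j _ => ?_
  rw [Finset.prod_congr rfl fun a ha => by rw [(Finset.mem_filter.1 ha).2], Finset.prod_const,
    Fintype.card_subtype]

/-! ### Characters of a finite torus -/

/-- The coordinate functions of the finite torus `(ℤ/N)ⁿ`, with values roots of unity. -/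
noncomputable def phase {n N : ℕ} [NeZero N] (g : Fin n → ZMod N) (j : Fin n) : ℂ :=
  ZMod.stdAddChar (g j)

@[simp]
theorem norm_phase {n N : ℕ} [NeZero N] (g : Fin n → ZMod N) (j : Fin n) : ‖phase g j‖ = 1 := by
  rw [phase, ZMod.stdAddChar_apply, Circle.norm_coe]

/-- The sum factors over the coordinates, and a single nontrivial character already makes its factor
vanish. -/
theorem sum_prod_stdAddChar {n N : ℕ} [NeZero N] (d : Fin n → ZMod N) :
    ∑ g : Fin n → ZMod N, ∏ j, ZMod.stdAddChar (g j * d j) =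
      if d = 0 then (N : ℂ) ^ n else 0 := by
  have h := Finset.prod_univ_sum (fun _ : Fin n => (Finset.univ : Finset (ZMod N)))
    (fun j t => ZMod.stdAddChar (t * d j))
  rw [Fintype.piFinset_univ] at h
  rw [← h]
  simp_rw [AddChar.sum_mulShift _ (ZMod.isPrimitive_stdAddChar N), ZMod.card]
  split_ifs with hd
  · subst hd
    simp
  · obtain ⟨j, hj⟩ := Function.ne_iff.1 hd
    exact Finset.prod_eq_zero (Finset.mem_univ j)
      (by rw [if_neg (show ¬d j = 0 from hj), Nat.cast_zero])

theorem phase_pow {n N : ℕ} [NeZero N] (g : Fin n → ZMod N) (j : Fin n) (c : ℕ) :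
    phase g j ^ c = ZMod.stdAddChar (g j * (c : ZMod N)) := by
  rw [phase, ← AddChar.map_nsmul_eq_pow, nsmul_eq_mul, mul_comm]

theorem conj_phase_pow {n N : ℕ} [NeZero N] (g : Fin n → ZMod N) (j : Fin n) (c : ℕ) :
    (starRingEnd ℂ) (phase g j ^ c) = ZMod.stdAddChar (g j * -(c : ZMod N)) := by
  rw [phase_pow, mul_neg, AddChar.map_neg_eq_conj]

theorem card_torus (n m : ℕ) :
    (Fintype.card (Fin n → ZMod (m + 1)) : ℝ) = ((m + 1 : ℕ) : ℝ) ^ n := by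
  rw [Fintype.card_fun, ZMod.card, Fintype.card_fin, Nat.cast_pow]

/-- Orthogonality of monomials on the finite torus. -/
theorem sum_prod_phase_pow_mul_conj {n N : ℕ} [NeZero N] (c k : Fin n → ℕ)
    (hc : ∀ j, c j < N) (hk : ∀ j, k j < N) :
    ∑ g : Fin n → ZMod N, (∏ j, phase g j ^ c j) * ∏ j, (starRingEnd ℂ) (phase g j ^ k j) =
      if c = k then (N : ℂ) ^ n else 0 := by
  have h : ∀ g : Fin n → ZMod N,
      (∏ j, phase g j ^ c j) * ∏ j, (starRingEnd ℂ) (phase g j ^ k j) =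
        ∏ j, ZMod.stdAddChar (g j * ((c j : ZMod N) - (k j : ZMod N))) := fun g => by
    rw [← Finset.prod_mul_distrib]
    refine Finset.prod_congr rfl fun j _ => ?_
    rw [phase_pow, conj_phase_pow, ← AddChar.map_add_eq_mul, ← mul_add, sub_eq_add_neg]
  rw [Finset.sum_congr rfl fun g _ => h g,
    sum_prod_stdAddChar fun j => (c j : ZMod N) - (k j : ZMod N)]
  refine if_congr ⟨fun h => funext fun j => ?_, ?_⟩ rfl rfl
  -- Orthogonality only gives equality of exponents modulo `N`; both are below `N`, so they agree.
  · have := sub_eq_zero.1 (congrFun h j)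
    rwa [ZMod.natCast_eq_natCast_iff', Nat.mod_eq_of_lt (hc j), Nat.mod_eq_of_lt (hk j)] at this
  · rintro rfl
    exact funext fun j => sub_self _

/-! ### Extracting a coefficient of a homogeneous polynomial -/

section Coefficient

variable {X : Type*} [NormedAddCommGroup X] [NormedSpace ℂ X] {n : ℕ}

/-- Multilinear expansion over choice functions `r`. Terms are left ungrouped, so no symmetry is
needed yet; the fibre sizes of `r` are the exponents of the monomial. -/
theorem assocPoly_sum_smul {m : ℕ} (L : ContinuousMultilinearMap ℂ (fun _ : Fin m => X) ℂ)
    (c : Fin n → ℂ) (x : Fin n → X) :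
    assocPoly L (∑ j, c j • x j) =
      ∑ r : Fin m → Fin n, (∏ j, c j ^ Fintype.card {i // r i = j}) * L (x ∘ r) := by
  rw [assocPoly, ContinuousMultilinearMap.map_sum]
  refine Finset.sum_congr rfl fun r _ => ?_
  rw [ContinuousMultilinearMap.map_smul_univ, prod_comp_eq_prod_pow_card r c, smul_eq_mul]
  rfl

theorem evalBlocks_smul (k : Fin n → ℕ)
    (L : ContinuousMultilinearMap ℂ (fun _ : Fin (∑ j, k j) => X) ℂ) (c : Fin n → ℂ)
    (x : Fin n → X) :
    evalBlocks k L (fun j => c j • x j) = (∏ j, c j ^ k j) * evalBlocks k L x := by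
  have h := L.map_smul_univ (fun i => c (blockIndex k i)) (fun i => x (blockIndex k i))
  rw [prod_comp_eq_prod_pow_card (blockIndex k) c, smul_eq_mul] at h
  simp_rw [card_blockIndex_eq] at h
  exact h

/-- Fourier extraction of one coefficient: `N > m` prevents aliasing, so only the choice functions
with fibre sizes `k` survive, and symmetry makes their contributions equal. -/
theorem sum_conj_phase_mul_assocPoly (k : Fin n → ℕ) {N : ℕ} [NeZero N] (hN : ∑ j, k j < N)
    (L : ContinuousMultilinearMap ℂ (fun _ : Fin (∑ j, k j) => X) ℂ) (hL : IsSymmetricForm L)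
    (x : Fin n → X) :
    ∑ g : Fin n → ZMod N,
        (∏ j, (starRingEnd ℂ) (phase g j ^ k j)) * assocPoly L (∑ j, phase g j • x j) =
      (N : ℂ) ^ n * (((∑ j, k j)! : ℂ) / ∏ j, ((k j)! : ℂ)) * evalBlocks k L x := by
  have hk : ∀ j, k j < N := fun j =>
    (Finset.single_le_sum (fun i _ => Nat.zero_le (k i)) (Finset.mem_univ j)).trans_lt hN
  have hr : ∀ (r : Fin (∑ j, k j) → Fin n) (j : Fin n),
      Fintype.card {i // r i = j} < N := fun r j =>
    ((Fintype.card_subtype_le _).trans_eq (Fintype.card_fin _)).trans_lt hN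
  simp_rw [assocPoly_sum_smul, Finset.mul_sum]
  rw [Finset.sum_comm]
  have hsum : ∀ r : Fin (∑ j, k j) → Fin n,
      ∑ g : Fin n → ZMod N, (∏ j, (starRingEnd ℂ) (phase g j ^ k j)) *
          ((∏ j, phase g j ^ Fintype.card {i // r i = j}) * L (x ∘ r)) =
        if ∀ j, Fintype.card {i // r i = j} = Fintype.card {i // blockIndex k i = j} then
          (N : ℂ) ^ n * evalBlocks k L x else 0 := fun r => by
    have h := sum_prod_phase_pow_mul_conj (N := N) (fun j => Fintype.card {i // r i = j}) k
      (hr r) hk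
    rw [Finset.sum_congr rfl fun g _ => show _ =
      ((∏ j, phase g j ^ Fintype.card {i // r i = j}) *
        ∏ j, (starRingEnd ℂ) (phase g j ^ k j)) * L (x ∘ r) by ring, ← Finset.sum_mul, h, ite_mul,
      zero_mul]
    simp_rw [card_blockIndex_eq]
    refine ite_congr (propext funext_iff) (fun hrk => ?_) fun _ => rfl
    -- A surviving `r` is a rearrangement of the block map, which the symmetric form does not see.
    obtain ⟨σ, hσ⟩ := exists_perm_comp_eq (f := blockIndex k) (r := r)
      fun j => (hrk j).trans (card_blockIndex_eq k j).symm
    rw [← hσ, evalBlocks_eq, ← hL σ (x ∘ blockIndex k)]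
    rfl
  rw [Finset.sum_congr rfl fun r _ => hsum r, ← Finset.sum_filter, Finset.sum_const, nsmul_eq_mul]
  have hcard := card_filter_fiber_eq_mul (blockIndex k)
  rw [Fintype.card_fin, Finset.prod_congr rfl fun j _ => by rw [card_blockIndex_eq]] at hcard
  have h0 : (∏ j, ((k j)! : ℂ)) ≠ 0 :=
    Finset.prod_ne_zero_iff.2 fun j _ => Nat.cast_ne_zero.2 (Nat.factorial_ne_zero _)
  have hcard' := congrArg (Nat.cast : ℕ → ℂ) hcard
  push_cast at hcard'
  rw [← hcard', mul_div_cancel_right₀ _ h0, mul_comm,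
    mul_right_comm ((N : ℂ) ^ n) _ (evalBlocks k L x)]
  congr!

end Coefficient

/-! ### Polarization constants and averages over the torus -/

/-- Comparison of the `m`-th and `t`-th means of a finite family, for `m ≤ t`. -/
theorem sum_pow_le_card_mul_of_sum_rpow_le {ι : Type*} [Fintype ι] [Nonempty ι] {f : ι → ℝ}
    (hf : ∀ i, 0 ≤ f i) {m : ℕ} {t B : ℝ} (hmt : (m : ℝ) ≤ t) (hB : 0 ≤ B)
    (h : ∑ i, f i ^ t ≤ Fintype.card ι * B ^ t) :
    ∑ i, f i ^ m ≤ Fintype.card ι * B ^ m := by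
  rcases Nat.eq_zero_or_pos m with rfl | hm
  · simp
  have hm' : (0 : ℝ) < m := Nat.cast_pos.2 hm
  have ht : 0 < t := hm'.trans_le hmt
  have hc : (0 : ℝ) < Fintype.card ι := Nat.cast_pos.2 Fintype.card_pos
  -- Jensen's inequality for the convex power `t / m ≥ 1` with uniform weights.
  have hmean := Real.rpow_arith_mean_le_arith_mean_rpow Finset.univ
    (fun _ : ι => (Fintype.card ι : ℝ)⁻¹) (fun i => f i ^ m) (fun _ _ => by positivity)
    (by simp [hc.ne']) (fun i _ => pow_nonneg (hf i) m) ((one_le_div hm').2 hmt)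
  have hpow : ∀ x : ℝ, 0 ≤ x → (x ^ m) ^ (t / m) = x ^ t := fun x hx => by
    rw [← Real.rpow_natCast, ← Real.rpow_mul hx, mul_div_cancel₀ _ hm'.ne']
  simp_rw [← Finset.mul_sum, hpow _ (hf _)] at hmean
  have h2 : ((Fintype.card ι : ℝ)⁻¹ * ∑ i, f i ^ m) ^ (t / m) ≤ (B ^ m) ^ (t / m) := by
    rw [hpow B hB]
    exact hmean.trans ((inv_mul_le_iff₀ hc).2 h)
  rw [Real.rpow_le_rpow_iff (mul_nonneg (by positivity)
    (Finset.sum_nonneg fun i _ => pow_nonneg (hf i) m)) (by positivity) (by positivity)] at h2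
  exact (inv_mul_le_iff₀ hc).1 h2

section Bound

variable {X : Type*} [NormedAddCommGroup X] [NormedSpace ℂ X] {n : ℕ}

theorem polyNorm_nonneg {m : ℕ} (L : ContinuousMultilinearMap ℂ (fun _ : Fin m => X) ℂ) :
    0 ≤ polyNorm L :=
  Real.iSup_nonneg fun _ => norm_nonneg _

theorem norm_assocPoly_le {m : ℕ} (L : ContinuousMultilinearMap ℂ (fun _ : Fin m => X) ℂ) (x : X) :
    ‖assocPoly L x‖ ≤ polyNorm L * ‖x‖ ^ m := by
  have hball : ∀ u : X, ‖u‖ ≤ 1 → ‖assocPoly L u‖ ≤ polyNorm L := fun u hu =>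
    le_ciSup (bddAbove_polyNorm L) ⟨u, mem_closedBall_zero_iff.2 hu⟩
  rcases eq_or_ne x 0 with rfl | hx
  -- In degree `0` the polynomial is a constant and `‖0‖ ^ 0 = 1`, so the origin cannot be dismissed
  -- as a zero.
  · rcases Nat.eq_zero_or_pos m with rfl | hm
    · simpa using hball 0 (by simp)
    · rw [assocPoly, L.map_coord_zero ⟨0, hm⟩ rfl, norm_zero]
      exact mul_nonneg (polyNorm_nonneg L) (by positivity)
  have hx' : ‖x‖ ≠ 0 := norm_ne_zero_iff.2 hx
  have h := L.map_smul_univ (fun _ => ((‖x‖ : ℝ) : ℂ)) (fun _ => ((‖x‖ : ℝ) : ℂ)⁻¹ • x)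
  rw [smul_inv_smul₀ (Complex.ofReal_ne_zero.2 hx')] at h
  rw [assocPoly, h, norm_smul, mul_comm]
  simp only [Finset.prod_const, Finset.card_univ, Fintype.card_fin, norm_pow, Complex.norm_real,
    norm_norm]
  refine mul_le_mul_of_nonneg_right (hball _ ?_) (by positivity)
  rw [norm_smul, norm_inv, Complex.norm_real, norm_norm, inv_mul_cancel₀ hx']

theorem prod_pow_self_pos (k : Fin n → ℕ) : 0 < ∏ j, (k j : ℝ) ^ k j :=
  Finset.prod_pos fun _ _ => mod_cast Nat.pow_self_pos

theorem polarizationBound_pos (k : Fin n → ℕ) (q : ℝ≥0∞) : 0 < polarizationBound k q := by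
  have h1 : (0 : ℝ) < ((∑ j, k j : ℕ) : ℝ) ^ (∑ j, k j) := mod_cast Nat.pow_self_pos
  have h2 := prod_pow_self_pos k
  have h3 : (0 : ℝ) < ∏ j, ((k j)! : ℝ) :=
    Finset.prod_pos fun j _ => Nat.cast_pos.2 (Nat.factorial_pos _)
  have h4 : (0 : ℝ) < ((∑ j, k j)! : ℝ) := Nat.cast_pos.2 (Nat.factorial_pos _)
  unfold polarizationBound
  positivity

theorem polarizationConst_le_of_forall {k : Fin n → ℕ} {M : ℝ} (hM : 0 < M)
    (h : ∀ L : ContinuousMultilinearMap ℂ (fun _ : Fin (∑ j, k j) => X) ℂ, IsSymmetricForm L →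
      ∀ x : Fin n → X, (∀ j, ‖x j‖ ≤ 1) → ‖evalBlocks k L x‖ ≤ M * polyNorm L) :
    polarizationConst k X ≤ ENNReal.ofReal M := by
  refine iInf₂_le M.toNNReal ⟨Real.toNNReal_pos.2 hM, fun L hL => ?_⟩
  rw [Real.coe_toNNReal _ hM.le]
  have : Nonempty (Fin n → Metric.closedBall (0 : X) 1) := ⟨fun _ => ⟨0, by simp⟩⟩
  exact ciSup_le fun x => h L hL _ fun j => mem_closedBall_zero_iff.1 (x j).2

/-- A type inequality for averages over the finite torus bounds the polarization constant. -/
theorem polarizationConst_le_of_sum_norm_rpow_le (k : Fin n → ℕ) {q t : ℝ} (hq : 0 < q)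
    (hmt : ((∑ j, k j : ℕ) : ℝ) ≤ t)
    (H : ∀ x : Fin n → X, ∑ g : Fin n → ZMod (∑ j, k j + 1), ‖∑ j, phase g j • x j‖ ^ t ≤
      Fintype.card (Fin n → ZMod (∑ j, k j + 1)) * (∑ j, ‖x j‖ ^ q) ^ (t / q)) :
    polarizationConst k X ≤ ENNReal.ofReal (polarizationBound k (ENNReal.ofReal q)) := by
  refine polarizationConst_le_of_forall (polarizationBound_pos k _) fun L hL x hx => ?_
  -- The weights `c j = (k j) ^ (1 / q)` maximise `∏ c j ^ k j` subject to `∑ c j ^ q = m`; they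
  -- produce the factor `∏ (k j) ^ (k j)` of the bound.
  have hcoef := sum_conj_phase_mul_assocPoly k (N := ∑ j, k j + 1) (Nat.lt_succ_self _) L hL
    (fun j => (((k j : ℝ) ^ (1 / q) : ℝ) : ℂ) • x j)
  rw [evalBlocks_smul] at hcoef
  set y : Fin n → X := fun j => (((k j : ℝ) ^ (1 / q) : ℝ) : ℂ) • x j with hy
  have hynorm : ∑ j, ‖y j‖ ^ q ≤ (∑ j, k j : ℕ) := by
    rw [Nat.cast_sum]
    refine Finset.sum_le_sum fun j _ => ?_
    rw [hy, norm_smul, Complex.norm_real, Real.norm_of_nonneg (by positivity),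
      Real.mul_rpow (by positivity) (norm_nonneg _), ← Real.rpow_mul (by positivity),
      one_div_mul_cancel hq.ne', Real.rpow_one]
    exact mul_le_of_le_one_right (by positivity)
      (Real.rpow_le_one (norm_nonneg _) (hx j) hq.le)
  have hsum : ∑ g : Fin n → ZMod (∑ j, k j + 1), ‖∑ j, phase g j • y j‖ ^ (∑ j, k j) ≤
      Fintype.card (Fin n → ZMod (∑ j, k j + 1)) *
        (((∑ j, k j : ℕ) : ℝ) ^ (1 / q)) ^ (∑ j, k j) := by
    refine sum_pow_le_card_mul_of_sum_rpow_le (fun _ => norm_nonneg _) hmt (by positivity) ?_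
    refine (H y).trans (mul_le_mul_of_nonneg_left ?_ (by positivity))
    rw [← Real.rpow_mul (by positivity), one_div_mul_eq_div]
    have ht : 0 ≤ t := (Nat.cast_nonneg (∑ j, k j)).trans hmt
    exact Real.rpow_le_rpow (by positivity) hynorm (by positivity)
  have hle : ‖∑ g : Fin n → ZMod (∑ j, k j + 1), (∏ j, (starRingEnd ℂ) (phase g j ^ k j)) *
      assocPoly L (∑ j, phase g j • y j)‖ ≤
      polyNorm L * (Fintype.card (Fin n → ZMod (∑ j, k j + 1)) *
        (((∑ j, k j : ℕ) : ℝ) ^ (1 / q)) ^ (∑ j, k j)) := by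
    refine (norm_sum_le _ _).trans (le_trans (Finset.sum_le_sum fun g _ => ?_)
      ((Finset.mul_sum _ _ _).ge.trans (mul_le_mul_of_nonneg_left hsum (polyNorm_nonneg L))))
    rw [norm_mul, norm_prod]
    simp only [RCLike.norm_conj, norm_pow, norm_phase, one_pow, Finset.prod_const_one, one_mul]
    exact norm_assocPoly_le L _
  have hN : (0 : ℝ) < ((∑ j, k j + 1 : ℕ) : ℝ) ^ n := by positivity
  have hcpow : ∏ j, (((k j : ℝ) ^ (1 / q)) ^ k j) = (∏ j, (k j : ℝ) ^ k j) ^ (1 / q) := by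
    rw [← Real.finsetProd_rpow _ _ fun j _ => by positivity]
    refine Finset.prod_congr rfl fun j _ => ?_
    rw [← Real.rpow_mul_natCast (by positivity), mul_comm, Real.rpow_natCast_mul (by positivity)]
  have hmpow : (((∑ j, k j : ℕ) : ℝ) ^ (1 / q)) ^ (∑ j, k j) =
      (((∑ j, k j : ℕ) : ℝ) ^ (∑ j, k j)) ^ (1 / q) := by
    rw [← Real.rpow_mul_natCast (by positivity), mul_comm, Real.rpow_natCast_mul (by positivity)]
  rw [hcoef, card_torus, hmpow] at hle
  simp only [norm_mul, norm_div, norm_pow, norm_prod, Complex.norm_natCast, Complex.norm_real]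
    at hle
  simp_rw [Real.norm_of_nonneg (Real.rpow_nonneg (Nat.cast_nonneg (α := ℝ) _) (1 / q))] at hle
  rw [hcpow] at hle
  have hP := Real.rpow_pos_of_pos (prod_pow_self_pos k) (1 / q)
  have h3 : (0 : ℝ) < ∏ j, ((k j)! : ℝ) :=
    Finset.prod_pos fun j _ => Nat.cast_pos.2 (Nat.factorial_pos _)
  have h4 : (0 : ℝ) < ((∑ j, k j)! : ℝ) := Nat.cast_pos.2 (Nat.factorial_pos _)
  have hq' : (1 / ENNReal.ofReal q).toReal = 1 / q := by
    rw [ENNReal.toReal_div, ENNReal.toReal_one, ENNReal.toReal_ofReal hq.le]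
  rw [polarizationBound, hq', Real.div_rpow (by positivity) (prod_pow_self_pos k).le]
  have h5 : ((∑ j, k j + 1 : ℕ) : ℝ) ^ n * (((∑ j, k j)! : ℝ) / ∏ j, ((k j)! : ℝ)) *
      (∏ j, (k j : ℝ) ^ k j) ^ (1 / q) * ‖evalBlocks k L x‖ ≤
      polyNorm L * (((∑ j, k j + 1 : ℕ) : ℝ) ^ n *
        (((∑ j, k j : ℕ) : ℝ) ^ (∑ j, k j)) ^ (1 / q)) := by
    rw [← mul_assoc] at hle
    exact hle
  set E := ‖evalBlocks k L x‖
  set A := (((∑ j, k j : ℕ) : ℝ) ^ (∑ j, k j)) ^ (1 / q)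
  set P := (∏ j, (k j : ℝ) ^ k j) ^ (1 / q)
  set F := ∏ j, ((k j)! : ℝ)
  have h6 : ((∑ j, k j)! : ℝ) / F * P * E ≤ polyNorm L * A := by
    refine le_of_mul_le_mul_left ?_ hN
    linarith
  have h7 : A / P * (F / (∑ j, k j)!) * polyNorm L =
      polyNorm L * A / (((∑ j, k j)! : ℝ) / F * P) := by
    field_simp
  rw [h7, le_div_iff₀ (by positivity)]
  linarith

/-- The bound valid in every normed space. -/
theorem polarizationConst_le_one (k : Fin n → ℕ) :
    polarizationConst k X ≤ ENNReal.ofReal (polarizationBound k 1) := by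
  rw [← ENNReal.ofReal_one]
  -- For `q = 1` and `t = m` the type inequality holds term by term, by the triangle inequality.
  refine polarizationConst_le_of_sum_norm_rpow_le k one_pos le_rfl fun x => ?_
  rw [← nsmul_eq_mul, ← Finset.card_univ]
  refine Finset.sum_le_card_nsmul _ _ _ fun g _ => ?_
  rw [div_one]
  refine Real.rpow_le_rpow (norm_nonneg _) ((norm_sum_le _ _).trans_eq ?_) (Nat.cast_nonneg _)
  simp [norm_smul]

end Bound

/-- In degree at most `1` the polarization bound does not depend on the exponent. -/
theorem polarizationBound_eq_one {n : ℕ} {k : Fin n → ℕ} (hk : ∑ j, k j ≤ 1) (q : ℝ≥0∞) :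
    polarizationBound k q = 1 := by
  have hj : ∀ j, k j = 0 ∨ k j = 1 := fun j => Nat.le_one_iff_eq_zero_or_eq_one.1
    ((Finset.single_le_sum (fun i _ => Nat.zero_le (k i)) (Finset.mem_univ j)).trans hk)
  have h1 : ∏ j, (k j : ℝ) ^ k j = 1 :=
    Finset.prod_eq_one fun j _ => by rcases hj j with h | h <;> simp [h]
  have h2 : ∏ j, ((k j)! : ℝ) = 1 :=
    Finset.prod_eq_one fun j _ => by rcases hj j with h | h <;> simp [h]
  rw [polarizationBound, h1, h2]
  rcases Nat.le_one_iff_eq_zero_or_eq_one.1 hk with h | h <;> simp [h]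

/-! ### Interpolation: the Hausdorff–Young inequality on a finite torus -/

/-- The analytic family `z ↦ (a / ‖a‖) * ‖a‖ ^ (p * (1 - z / 2))` used to interpolate between
`ℓ¹` and `ℓ²`. -/
noncomputable def interpFamily (p : ℝ) (a z : ℂ) : ℂ :=
  a / ‖a‖ * Complex.exp (Real.log ‖a‖ * (p * (1 - z / 2)))

theorem differentiable_interpFamily (p : ℝ) (a : ℂ) : Differentiable ℂ (interpFamily p a) := by
  unfold interpFamily
  fun_prop

theorem norm_interpFamily {p : ℝ} {a : ℂ} (ha : a ≠ 0) (z : ℂ) :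
    ‖interpFamily p a z‖ = ‖a‖ ^ (p * (1 - z.re / 2)) := by
  have ha' : 0 < ‖a‖ := norm_pos_iff.2 ha
  rw [interpFamily, norm_mul, norm_div, Complex.norm_real, norm_norm, div_self ha'.ne', one_mul,
    Complex.norm_exp, Real.rpow_def_of_pos ha']
  congr 1
  simp [Complex.mul_re, Complex.mul_im]

/-- Only an inequality survives at `a = 0`: the family vanishes there, but the right side is `1`
when the exponent is `0`. -/
theorem norm_interpFamily_le (p : ℝ) (a z : ℂ) :
    ‖interpFamily p a z‖ ≤ ‖a‖ ^ (p * (1 - z.re / 2)) := by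
  rcases eq_or_ne a 0 with rfl | ha
  · rw [interpFamily, zero_div, zero_mul, norm_zero]
    exact Real.rpow_nonneg le_rfl _
  · exact (norm_interpFamily ha z).le

theorem interpFamily_apply_of_mul_eq_one {p θ : ℝ} (h : p * (1 - θ / 2) = 1) (a : ℂ) :
    interpFamily p a θ = a := by
  rcases eq_or_ne a 0 with rfl | ha
  · simp [interpFamily]
  have ha' : 0 < ‖a‖ := norm_pos_iff.2 ha
  have h' : ((p : ℂ) * (1 - (θ : ℂ) / 2)) = 1 := by exact_mod_cast congrArg Complex.ofReal h
  rw [interpFamily, h', mul_one, ← Complex.ofReal_exp, Real.exp_log ha',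
    div_mul_cancel₀ _ (Complex.ofReal_ne_zero.2 ha'.ne')]

section Interpolation

variable {ι κ : Type*} [Fintype ι] [Fintype κ]

/-- Riesz–Thorin interpolation for a bilinear form, between `ℓ¹ × ℓ¹` and `ℓ² × ℓ²`, on
normalized families. -/
theorem norm_sum_mul_le_rpow_of_normalized {A : κ → ι → ℂ} (hA : ∀ g j, ‖A g j‖ ≤ 1) {C : ℝ}
    (hC : 0 < C)
    (hA2 : ∀ a : ι → ℂ, ∑ g, ‖∑ j, A g j * a j‖ ^ 2 ≤ C * ∑ j, ‖a j‖ ^ 2) {p q : ℝ}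
    (hpq : p.HolderConjugate q) (hq : 2 ≤ q) {a : ι → ℂ} {b : κ → ℂ} (ha : ∑ j, ‖a j‖ ^ p = 1)
    (hb : ∑ g, ‖b g‖ ^ p = 1) :
    ‖∑ g, (∑ j, A g j * a j) * b g‖ ≤ C ^ (1 / q) := by
  have hp := hpq.pos
  have hq0 := hpq.symm.pos
  have hle : ∀ x : ℝ, 0 ≤ x → x ^ p ≤ 1 → x ≤ 1 := fun x hx h =>
    (Real.rpow_le_rpow_iff hx zero_le_one hp).1 (h.trans_eq (Real.one_rpow p).symm)
  have ha1 : ∀ j, ‖a j‖ ≤ 1 := fun j => hle _ (norm_nonneg _) (ha ▸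
    Finset.single_le_sum (f := fun j => ‖a j‖ ^ p)
      (fun i _ => Real.rpow_nonneg (norm_nonneg _) _) (Finset.mem_univ j))
  have hb1 : ∀ g, ‖b g‖ ≤ 1 := fun g => hle _ (norm_nonneg _) (hb ▸
    Finset.single_le_sum (f := fun g => ‖b g‖ ^ p)
      (fun i _ => Real.rpow_nonneg (norm_nonneg _) _) (Finset.mem_univ g))
  -- At `θ = 2 / q` the families return to the original vectors; the same `p` serves `a` and `b`
  -- because `ℓ^p` is the dual of the target `ℓ^q`.
  have hθ : p * (1 - 2 / q / 2) = 1 := by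
    rw [div_div_cancel_left' two_ne_zero, ← hpq.one_sub_inv, sub_sub_cancel,
      mul_inv_cancel₀ hp.ne']
  have hstrip : ∀ (c z : ℂ), ‖c‖ ≤ 1 → z.re ∈ Set.Icc (0 : ℝ) 1 → ‖interpFamily p c z‖ ≤ 1 :=
    fun c z hc hz => (norm_interpFamily_le p c z).trans (Real.rpow_le_one (norm_nonneg _) hc
      (mul_nonneg hp.le (by linarith [hz.2])))
  have hleft : ∀ (c z : ℂ), z.re = 0 → ‖interpFamily p c z‖ ≤ ‖c‖ ^ p := fun c z hz => by
    simpa [hz] using norm_interpFamily_le p c z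
  have hright : ∀ (c z : ℂ), z.re = 1 → ‖interpFamily p c z‖ ^ 2 ≤ ‖c‖ ^ p := fun c z hz => by
    refine (pow_le_pow_left₀ (norm_nonneg _) (norm_interpFamily_le p c z) 2).trans_eq ?_
    rw [hz, ← Real.rpow_mul_natCast (norm_nonneg _)]
    congr 1
    push_cast
    ring
  set F : ℂ → ℂ := fun z => ∑ g, (∑ j, A g j * interpFamily p (a j) z) * interpFamily p (b g) z
    with hF
  have hFd : Differentiable ℂ F := by
    have h := fun c => differentiable_interpFamily p c
    rw [hF]
    fun_prop
  have hFle : ∀ z, ‖F z‖ ≤ ∑ g, (∑ j, ‖interpFamily p (a j) z‖) * ‖interpFamily p (b g) z‖ :=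
    fun z => (norm_sum_le _ _).trans (Finset.sum_le_sum fun g _ => by
      rw [norm_mul]
      refine mul_le_mul_of_nonneg_right ((norm_sum_le _ _).trans
        (Finset.sum_le_sum fun j _ => ?_)) (norm_nonneg _)
      rw [norm_mul]
      exact mul_le_of_le_one_left (norm_nonneg _) (hA g j))
  -- The bounds `1` on `re z = 0` and `C ^ (1 / 2)` on `re z = 1` interpolate at `θ = 2 / q` to `C ^
  -- (θ / 2) = C ^ (1 / q)`.
  have hmain := Complex.HadamardThreeLines.norm_le_interp_of_mem_verticalClosedStrip₀₁' F
    (z := ((2 / q : ℝ) : ℂ)) (a := 1) (b := C ^ (1 / 2 : ℝ)) ?_ hFd.diffContOnCl ?_ ?_ ?_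
  · rw [Real.one_rpow, one_mul, ← Real.rpow_mul hC.le, Complex.ofReal_re,
      show (1 / 2 : ℝ) * (2 / q) = 1 / q by ring] at hmain
    simpa only [hF, interpFamily_apply_of_mul_eq_one hθ] using hmain
  · exact ⟨by rw [Complex.ofReal_re]; positivity,
      by rw [Complex.ofReal_re]; exact (div_le_one hq0).2 hq⟩
  · refine ⟨∑ _g : κ, (∑ _j : ι, 1) * 1, ?_⟩
    rintro _ ⟨z, hz, rfl⟩
    refine (hFle z).trans (Finset.sum_le_sum fun g _ => ?_)
    exact mul_le_mul (Finset.sum_le_sum fun j _ => hstrip _ z (ha1 j) hz) (hstrip _ z (hb1 g) hz)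
      (norm_nonneg _) (by positivity)
  -- On this edge both families lie in the unit ball of `ℓ¹`, so bounded matrix entries suffice.
  · intro z hz
    refine (hFle z).trans ?_
    rw [← Finset.mul_sum]
    exact mul_le_one₀ ((Finset.sum_le_sum fun j _ => hleft _ z hz).trans_eq ha)
      (Finset.sum_nonneg fun _ _ => norm_nonneg _)
      ((Finset.sum_le_sum fun g _ => hleft _ z hz).trans_eq hb)
  -- On this edge both families lie in the unit ball of `ℓ²`; Cauchy–Schwarz and `hA2` apply.
  · intro z hz
    rw [← Real.sqrt_eq_rpow]
    refine (norm_sum_le _ _).trans ((Finset.sum_le_sum fun g _ => (norm_mul _ _).le).trans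
      ((Real.sum_mul_le_sqrt_mul_sqrt _ _ _).trans ?_))
    have h1 : ∑ g, ‖∑ j, A g j * interpFamily p (a j) z‖ ^ 2 ≤ C :=
      (hA2 _).trans (mul_le_of_le_one_right hC.le
        ((Finset.sum_le_sum fun j _ => hright _ z hz).trans_eq ha))
    have h2 : ∑ g, ‖interpFamily p (b g) z‖ ^ 2 ≤ 1 :=
      (Finset.sum_le_sum fun g _ => hright _ z hz).trans_eq hb
    exact (mul_le_mul (Real.sqrt_le_sqrt h1) (Real.sqrt_le_one.2 h2) (Real.sqrt_nonneg _)
      (Real.sqrt_nonneg _)).trans_eq (mul_one _)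

/-- Riesz–Thorin interpolation for a matrix between `ℓ¹ → ℓ^∞` and `ℓ² → ℓ²`. -/
theorem sum_norm_rpow_le_of_l2_bound {A : κ → ι → ℂ} (hA : ∀ g j, ‖A g j‖ ≤ 1) {C : ℝ}
    (hC : 0 < C)
    (hA2 : ∀ a : ι → ℂ, ∑ g, ‖∑ j, A g j * a j‖ ^ 2 ≤ C * ∑ j, ‖a j‖ ^ 2) {p q : ℝ}
    (hpq : p.HolderConjugate q) (hq : 2 ≤ q) (a : ι → ℂ) :
    ∑ g, ‖∑ j, A g j * a j‖ ^ q ≤ C * (∑ j, ‖a j‖ ^ p) ^ (q / p) := by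
  have hp := hpq.pos
  have hq0 := hpq.symm.pos
  have hnorm : ∀ a : ι → ℂ, ∑ j, ‖a j‖ ^ p = 1 → ∑ g, ‖∑ j, A g j * a j‖ ^ q ≤ C := by
    intro a ha
    set y : κ → ℂ := fun g => ∑ j, A g j * a j with hy
    set Y := ∑ g, ‖y g‖ ^ q with hY
    rcases (Finset.sum_nonneg fun g _ => Real.rpow_nonneg (norm_nonneg (y g)) q).eq_or_lt with
      h0 | hY0
    · rw [hY, ← h0]
      exact hC.le
    rw [← hY] at hY0
    -- The norming functional of `y`: its `ℓ^p` norm is `1`, and pairing it with `y` gives the `ℓ^q`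
    -- norm `Y ^ (1 / q)`.
    set b : κ → ℂ := fun g =>
      (starRingEnd ℂ) (y g) * ((‖y g‖ ^ (q - 2) / Y ^ (1 / p) : ℝ) : ℂ) with hb
    have hypow : ∀ g, ‖y g‖ ^ 2 * ‖y g‖ ^ (q - 2) = ‖y g‖ ^ q := fun g => by
      rcases (norm_nonneg (y g)).eq_or_lt with h | h
      · rw [← h, Real.zero_rpow hq0.ne']
        simp
      · rw [← Real.rpow_natCast, ← Real.rpow_add h]
        congr 1
        push_cast
        ring
    have hYp : 0 < Y ^ (1 / p) := Real.rpow_pos_of_pos hY0 _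
    have hbnorm : ∀ g, ‖b g‖ ^ p = ‖y g‖ ^ q / Y := fun g => by
      rw [hb]
      simp only [norm_mul, RCLike.norm_conj, Complex.norm_real]
      rw [Real.norm_of_nonneg (by positivity), ← mul_div_assoc,
        Real.div_rpow (by positivity) hYp.le, ← Real.rpow_mul hY0.le, one_div_mul_cancel hp.ne',
        Real.rpow_one]
      congr 1
      rcases (norm_nonneg (y g)).eq_or_lt with h | h
      · rw [← h, zero_mul, Real.zero_rpow hq0.ne', Real.zero_rpow hp.ne']
      · rw [← Real.rpow_one_add' h.le (by linarith), ← Real.rpow_mul h.le]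
        congr 1
        have := hpq.mul_eq_add
        linarith
    have hbsum : ∑ g, ‖b g‖ ^ p = 1 := by
      simp_rw [hbnorm]
      rw [← Finset.sum_div, ← hY, div_self hY0.ne']
    have h := norm_sum_mul_le_rpow_of_normalized hA hC hA2 hpq hq ha hbsum
    have hprod : ∑ g, (∑ j, A g j * a j) * b g = ((Y ^ (1 / q) : ℝ) : ℂ) := by
      have hterm : ∀ g, y g * b g = ((‖y g‖ ^ q / Y ^ (1 / p) : ℝ) : ℂ) := fun g => by
        rw [hb, ← hypow g]
        simp only
        rw [← mul_assoc, Complex.mul_conj, Complex.normSq_eq_norm_sq]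
        push_cast
        ring
      rw [Finset.sum_congr rfl fun g _ => hterm g, ← Complex.ofReal_sum, ← Finset.sum_div, ← hY]
      congr 1
      rw [div_eq_iff hYp.ne', ← Real.rpow_add hY0, one_div, one_div, add_comm,
        hpq.inv_add_inv_eq_one, Real.rpow_one]
    rw [hprod, Complex.norm_real, Real.norm_of_nonneg (by positivity),
      Real.rpow_le_rpow_iff hY0.le hC.le (by positivity)] at h
    exact h
  set s := ∑ j, ‖a j‖ ^ p with hs
  rcases (Finset.sum_nonneg fun j _ => Real.rpow_nonneg (norm_nonneg (a j)) p).eq_or_lt with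
    h0 | hs0
  · have ha0 : ∀ j, a j = 0 := fun j => by
      have := (Finset.sum_eq_zero_iff_of_nonneg fun j _ =>
        Real.rpow_nonneg (norm_nonneg (a j)) p).1 h0.symm j (Finset.mem_univ j)
      exact norm_eq_zero.1 ((Real.rpow_eq_zero (norm_nonneg _) hp.ne').1 this)
    have hz : ∑ g, ‖∑ j, A g j * a j‖ ^ q = 0 :=
      Finset.sum_eq_zero fun g _ => by simp [ha0, Real.zero_rpow hq0.ne']
    rw [hz]
    exact mul_nonneg hC.le (Real.rpow_nonneg (hs ▸ h0.le) _)
  rw [← hs] at hs0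
  have hsp : 0 < s ^ (1 / p) := Real.rpow_pos_of_pos hs0 _
  -- Both sides are homogeneous of degree `q`, so it is enough to scale `a` to norm `1`.
  have h := hnorm (fun j => a j * ((s ^ (1 / p) : ℝ) : ℂ)⁻¹) ?_
  · simp_rw [← mul_assoc, ← Finset.sum_mul, norm_mul, norm_inv, Complex.norm_real,
      Real.norm_of_nonneg hsp.le, Real.mul_rpow (norm_nonneg _) (inv_nonneg.2 hsp.le)] at h
    rw [← Finset.sum_mul, Real.inv_rpow hsp.le, ← Real.rpow_mul hs0.le, one_div_mul_eq_div,
      ← div_eq_mul_inv, div_le_iff₀ (Real.rpow_pos_of_pos hs0 _)] at h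
    exact h
  · simp_rw [norm_mul, norm_inv, Complex.norm_real, Real.norm_of_nonneg hsp.le,
      Real.mul_rpow (norm_nonneg _) (inv_nonneg.2 hsp.le)]
    rw [← Finset.sum_mul, Real.inv_rpow hsp.le, ← Real.rpow_mul hs0.le, one_div_mul_cancel hp.ne',
      Real.rpow_one, ← hs, mul_inv_cancel₀ hs0.ne']

end Interpolation

/-- Orthogonality of monomials of degree one; `N > 1` keeps the exponents `0` and `1` distinct. -/
theorem sum_phase_mul_conj_phase {n N : ℕ} [NeZero N] (hN : 1 < N) (i j : Fin n) :
    ∑ g : Fin n → ZMod N, phase g i * (starRingEnd ℂ) (phase g j) =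
      if i = j then (N : ℂ) ^ n else 0 := by
  have h := sum_prod_phase_pow_mul_conj (N := N) (Pi.single i 1) (Pi.single j 1)
    (fun l => by rcases eq_or_ne l i with rfl | hl <;> simp [*]; omega)
    (fun l => by rcases eq_or_ne l j with rfl | hl <;> simp [*]; omega)
  have hprod : ∀ (g : Fin n → ZMod N) (l : Fin n),
      ∏ j, phase g j ^ (Pi.single l 1 : Fin n → ℕ) j = phase g l := fun g l => by
    rw [Finset.prod_eq_single l (fun j _ hj => by simp [hj]) (by simp)]
    simp
  simp_rw [← map_prod, hprod] at h
  rw [h]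
  refine if_congr ⟨fun hij => ?_, fun hij => by rw [hij]⟩ rfl rfl
  by_contra hne
  simpa [hne] using congrFun hij i

/-- Parseval's identity, which supplies the `ℓ²` endpoint of the interpolation with `C = N ^ n`. -/
theorem sum_norm_sum_phase_mul_sq {n N : ℕ} [NeZero N] (hN : 1 < N) (a : Fin n → ℂ) :
    ∑ g : Fin n → ZMod N, ‖∑ j, phase g j * a j‖ ^ 2 = (N : ℝ) ^ n * ∑ j, ‖a j‖ ^ 2 := by
  have h : ∀ z : ℂ, ((‖z‖ ^ 2 : ℝ) : ℂ) = z * (starRingEnd ℂ) z := fun z => by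
    rw [Complex.mul_conj, Complex.normSq_eq_norm_sq]
  apply Complex.ofReal_injective
  rw [Complex.ofReal_sum, Complex.ofReal_mul, Complex.ofReal_sum]
  simp_rw [h, map_sum, Finset.sum_mul_sum, map_mul]
  rw [Finset.sum_comm, Finset.mul_sum]
  refine Finset.sum_congr rfl fun i _ => ?_
  rw [Finset.sum_comm, Finset.sum_eq_single i]
  · rw [Finset.sum_congr rfl fun g _ => show _ =
      (phase g i * (starRingEnd ℂ) (phase g i)) * (a i * (starRingEnd ℂ) (a i)) by ring,
      ← Finset.sum_mul, sum_phase_mul_conj_phase hN, if_pos rfl]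
    push_cast
    rfl
  · intro j _ hj
    rw [Finset.sum_congr rfl fun g _ => show _ =
      (phase g i * (starRingEnd ℂ) (phase g j)) * (a i * (starRingEnd ℂ) (a j)) by ring,
      ← Finset.sum_mul, sum_phase_mul_conj_phase hN, if_neg hj.symm, zero_mul]
  · simp

/-- The Hausdorff–Young inequality for the coordinate characters of a finite torus. -/
theorem sum_norm_sum_phase_mul_rpow_le {n N : ℕ} [NeZero N] (hN : 1 < N) {p q : ℝ}
    (hpq : p.HolderConjugate q) (hq : 2 ≤ q) (a : Fin n → ℂ) :
    ∑ g : Fin n → ZMod N, ‖∑ j, phase g j * a j‖ ^ q ≤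
      (N : ℝ) ^ n * (∑ j, ‖a j‖ ^ p) ^ (q / p) :=
  sum_norm_rpow_le_of_l2_bound (fun g j => (norm_phase g j).le)
    (by have : 0 < N := by omega
        positivity)
    (fun a => (sum_norm_sum_phase_mul_sq hN a).le) hpq hq a

/-! ### Type inequalities in `L^p` -/

section LpType

variable {Ω : Type*} [MeasurableSpace Ω] {μ : Measure Ω}

theorem Lp_norm_rpow_toReal {E : Type*} [NormedAddCommGroup E] {p : ℝ≥0∞} [Fact (1 ≤ p)]
    (hp : p ≠ ∞) (f : Lp E p μ) : ‖f‖ ^ p.toReal = ∫ ω, ‖f ω‖ ^ p.toReal ∂μ := by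
  have hp0 : p ≠ 0 := (one_pos.trans_le Fact.out).ne'
  have h0 : 0 ≤ ∫ ω, ‖f ω‖ ^ p.toReal ∂μ := integral_nonneg fun ω => by positivity
  rw [Lp.norm_def, (Lp.memLp f).eLpNorm_eq_integral_rpow_norm hp0 hp,
    ENNReal.toReal_ofReal (by positivity), ← Real.rpow_mul h0,
    inv_mul_cancel₀ (ENNReal.toReal_pos hp0 hp).ne', Real.rpow_one]

theorem Lp_integrable_norm_rpow_toReal {E : Type*} [NormedAddCommGroup E] {p : ℝ≥0∞}
    [Fact (1 ≤ p)] (hp : p ≠ ∞) (f : Lp E p μ) : Integrable (fun ω => ‖f ω‖ ^ p.toReal) μ :=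
  (Lp.memLp f).integrable_norm_rpow (one_pos.trans_le Fact.out).ne' hp

variable {p : ℝ≥0∞} {n N : ℕ} [NeZero N]

theorem ae_sum_phase_smul_eq (x : Fin n → Lp ℂ p μ) :
    ∀ᵐ ω ∂μ, ∀ g : Fin n → ZMod N,
      (∑ j, phase g j • x j : Lp ℂ p μ) ω = ∑ j, phase g j * x j ω := by
  refine ae_all_iff.2 fun g => ?_
  have h2 : ∀ᵐ ω ∂μ, ∀ j, (phase g j • x j : Lp ℂ p μ) ω = phase g j * x j ω :=
    ae_all_iff.2 fun j => by
      filter_upwards [Lp.coeFn_smul (phase g j) (x j)] with ω hω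
      simpa using hω
  filter_upwards [Lp.coeFn_finsetSum Finset.univ fun j => phase g j • x j, h2] with ω h1 h2
  rw [h1, Finset.sum_apply]
  exact Finset.sum_congr rfl fun j _ => h2 j

variable [Fact (1 ≤ p)]

/-- `L^p` has type `p'`, with constant `1`, when `2 ≤ p < ∞`. -/
theorem sum_norm_sum_phase_smul_rpow_le_of_two_le (hN : 1 < N) (hp : p ≠ ∞) (hp2 : 2 ≤ p.toReal)
    {q : ℝ} (hpq : q.HolderConjugate p.toReal) (x : Fin n → Lp ℂ p μ) :
    ∑ g : Fin n → ZMod N, ‖∑ j, phase g j • x j‖ ^ p.toReal ≤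
      (N : ℝ) ^ n * (∑ j, ‖x j‖ ^ q) ^ (p.toReal / q) := by
  have hq := hpq.pos
  have hqp : q ≤ p.toReal := by
    have h1 := hpq.mul_eq_add
    nlinarith
  set Q : ℝ≥0∞ := ENNReal.ofReal q with hQ
  have hQr : Q.toReal = q := ENNReal.toReal_ofReal hq.le
  have hQ0 : Q ≠ 0 := (ENNReal.ofReal_pos.2 hq).ne'
  have hQt : Q ≠ ∞ := ENNReal.ofReal_ne_top
  have hR : (p / Q).toReal = p.toReal / q := by rw [ENNReal.toReal_div, hQr]
  have hRt : p / Q ≠ ∞ := ENNReal.div_ne_top hp hQ0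
  have hR1 : Fact (1 ≤ p / Q) := ⟨by
    rw [ENNReal.le_div_iff_mul_le (.inl hQ0) (.inl hQt), one_mul, hQ]
    exact ENNReal.ofReal_le_of_le_toReal hqp⟩
  have hR0 : 0 < p.toReal / q := by positivity
  have hmem : ∀ j, MemLp (fun ω => ‖x j ω‖ ^ q) (p / Q) μ := fun j => by
    simpa only [hQr] using (Lp.memLp (x j)).norm_rpow_div Q
  -- After the scalar inequality is integrated, `∑ |x j| ^ q` has to be measured in `L^(p / q)`.
  -- Since `q ≤ p` this is a normed space, and its triangle inequality finishes the estimate.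
  set H : Fin n → Lp ℝ (p / Q) μ := fun j => (hmem j).toLp with hH
  have hHcoe : ∀ᵐ ω ∂μ, ∀ j, H j ω = ‖x j ω‖ ^ q := ae_all_iff.2 fun j => (hmem j).coeFn_toLp
  have hpow : ∀ c : ℝ, 0 ≤ c → (c ^ q) ^ (p.toReal / q) = c ^ p.toReal := fun c hc => by
    rw [← Real.rpow_mul hc, mul_div_cancel₀ _ hq.ne']
  have hHnorm : ∀ j, ‖H j‖ = ‖x j‖ ^ q := fun j => by
    refine (Real.rpow_left_inj (norm_nonneg _) (by positivity) hR0.ne').1 ?_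
    rw [hpow _ (norm_nonneg _), Lp_norm_rpow_toReal hp, ← hR, Lp_norm_rpow_toReal hRt, hR]
    refine integral_congr_ae ?_
    filter_upwards [hHcoe] with ω hω
    rw [hω j, Real.norm_of_nonneg (by positivity), hpow _ (norm_nonneg _)]
  have hsum := ae_sum_phase_smul_eq (N := N) x
  calc ∑ g : Fin n → ZMod N, ‖∑ j, phase g j • x j‖ ^ p.toReal
      = ∫ ω, ∑ g : Fin n → ZMod N, ‖(∑ j, phase g j • x j : Lp ℂ p μ) ω‖ ^ p.toReal ∂μ := by
        rw [integral_finsetSum _ fun g _ => Lp_integrable_norm_rpow_toReal hp _]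
        exact Finset.sum_congr rfl fun g _ => Lp_norm_rpow_toReal hp _
    _ ≤ ∫ ω, (N : ℝ) ^ n * ‖(∑ j, H j : Lp ℝ (p / Q) μ) ω‖ ^ (p / Q).toReal ∂μ := by
        refine integral_mono_ae
          (integrable_finsetSum _ fun g _ => Lp_integrable_norm_rpow_toReal hp _)
          ((Lp_integrable_norm_rpow_toReal hRt _).const_mul _) ?_
        filter_upwards [hsum, hHcoe, Lp.coeFn_finsetSum Finset.univ H] with ω h1 h2 h3
        simp only [h1]
        rw [h3, Finset.sum_apply, Finset.sum_congr rfl fun j _ => h2 j, hR,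
          Real.norm_of_nonneg (by positivity)]
        exact sum_norm_sum_phase_mul_rpow_le hN hpq hp2 fun j => x j ω
    _ = (N : ℝ) ^ n * ‖∑ j, H j‖ ^ (p.toReal / q) := by
        rw [integral_const_mul, ← Lp_norm_rpow_toReal hRt, hR]
    _ ≤ (N : ℝ) ^ n * (∑ j, ‖x j‖ ^ q) ^ (p.toReal / q) := by
        have h : ‖∑ j, H j‖ ≤ ∑ j, ‖x j‖ ^ q :=
          (norm_sum_le _ _).trans_eq (Finset.sum_congr rfl fun j _ => hHnorm j)
        gcongr

/-- `L^p` has type `p`, with constant `1` and averages of order `p'`, when `1 < p ≤ 2`. -/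
theorem sum_norm_sum_phase_smul_rpow_le_of_le_two (hN : 1 < N) (hp : p ≠ ∞)
    {q : ℝ} (hpq : p.toReal.HolderConjugate q) (hq2 : 2 ≤ q) (x : Fin n → Lp ℂ p μ) :
    ∑ g : Fin n → ZMod N, ‖∑ j, phase g j • x j‖ ^ q ≤
      (N : ℝ) ^ n * (∑ j, ‖x j‖ ^ p.toReal) ^ (q / p.toReal) := by
  have hp0 := hpq.pos
  have hpq' : p.toReal ≤ q := by
    have h1 := hpq.mul_eq_add
    nlinarith
  set r : ℝ := q / p.toReal with hr
  have hr1 : 1 ≤ r := (one_le_div hp0).2 hpq'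
  have hr0 : 0 < r := one_pos.trans_le hr1
  have hR : (ENNReal.ofReal r).toReal = r := ENNReal.toReal_ofReal hr0.le
  have hRf : Fact (1 ≤ ENNReal.ofReal r) := ⟨ENNReal.one_le_ofReal.2 hr1⟩
  have hpow : ∀ c : ℝ, 0 ≤ c → (c ^ p.toReal) ^ r = c ^ q := fun c hc => by
    rw [← Real.rpow_mul hc, mul_div_cancel₀ _ hp0.ne']
  have hN0 : (0 : ℝ) < (N : ℝ) ^ n := by
    have : 0 < N := by omega
    positivity
  -- Here the mean has order `q ≥ p`, so it cannot be integrated pointwise. Minkowski's inequality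
  -- exchanges the two norms: the `ℓ^(q / p)` norm of the integral of `v` is at most the integral of
  -- its norm.
  set v : Ω → PiLp (ENNReal.ofReal r) (fun _ : Fin n → ZMod N => ℝ) := fun ω =>
    WithLp.toLp _ fun g => ‖(∑ j, phase g j • x j : Lp ℂ p μ) ω‖ ^ p.toReal with hv
  have hvint : ∀ g, Integrable (fun ω => v ω g) μ := fun g => Lp_integrable_norm_rpow_toReal hp _
  have hleft : ‖∫ ω, v ω ∂μ‖ =
      (∑ g : Fin n → ZMod N, ‖∑ j, phase g j • x j‖ ^ q) ^ (1 / r) := by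
    rw [PiLp.norm_eq_sum (by rw [hR]; exact hr0), hR]
    congr 1
    refine Finset.sum_congr rfl fun g _ => ?_
    rw [eval_integral_piLp hvint]
    simp only [hv]
    rw [← Lp_norm_rpow_toReal hp, Real.norm_of_nonneg (by positivity), hpow _ (norm_nonneg _)]
  have hright : ∫ ω, ‖v ω‖ ∂μ ≤ ((N : ℝ) ^ n) ^ (1 / r) * ∑ j, ‖x j‖ ^ p.toReal := by
    calc ∫ ω, ‖v ω‖ ∂μ
        ≤ ∫ ω, ((N : ℝ) ^ n) ^ (1 / r) * ∑ j, ‖x j ω‖ ^ p.toReal ∂μ := by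
          refine integral_mono_ae (Integrable.of_eval_piLp hvint).norm
            ((integrable_finsetSum _ fun j _ => Lp_integrable_norm_rpow_toReal hp _).const_mul _)
            ?_
          filter_upwards [ae_sum_phase_smul_eq (N := N) x] with ω hω
          rw [PiLp.norm_eq_sum (by rw [hR]; exact hr0), hR]
          have hterm : ∀ g, ‖v ω g‖ ^ r = ‖∑ j, phase g j * x j ω‖ ^ q := fun g => by
            simp only [hv, hω g]
            rw [Real.norm_of_nonneg (by positivity), hpow _ (norm_nonneg _)]
          simp_rw [hterm]
          have h := sum_norm_sum_phase_mul_rpow_le hN hpq hq2 fun j => x j ω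
          refine (Real.rpow_le_rpow (by positivity) h (by positivity)).trans_eq ?_
          rw [Real.mul_rpow hN0.le (by positivity), ← hr, ← Real.rpow_mul (by positivity),
            mul_one_div_cancel hr0.ne', Real.rpow_one]
      _ = ((N : ℝ) ^ n) ^ (1 / r) * ∑ j, ‖x j‖ ^ p.toReal := by
          rw [integral_const_mul,
            integral_finsetSum _ fun j _ => Lp_integrable_norm_rpow_toReal hp _]
          simp_rw [Lp_norm_rpow_toReal hp]
  have h := (norm_integral_le_integral_norm v).trans hright
  rw [hleft] at h
  have h2 := Real.rpow_le_rpow (by positivity) h hr0.le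
  rwa [← Real.rpow_mul (by positivity), one_div_mul_cancel hr0.ne', Real.rpow_one,
    Real.mul_rpow (by positivity) (by positivity), ← Real.rpow_mul hN0.le,
    one_div_mul_cancel hr0.ne', Real.rpow_one] at h2

end LpType

/-! ### The upper estimates -/

section UpperBound

variable {Ω : Type*} [MeasurableSpace Ω] (μ : Measure Ω) {n : ℕ} (k : Fin n → ℕ)
  {p : ℝ≥0∞} [Fact (1 ≤ p)]

theorem polarizationConst_Lp_le_of_sum_le_one (hk : ∑ j, k j ≤ 1) (q : ℝ≥0∞) :
    polarizationConst k (Lp ℂ p μ) ≤ ENNReal.ofReal (polarizationBound k q) := by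
  rw [polarizationBound_eq_one hk, ← polarizationBound_eq_one hk 1]
  exact polarizationConst_le_one k

theorem conjExponent_ofReal {r : ℝ} (hr : 1 < r) :
    ENNReal.conjExponent (ENNReal.ofReal r) = ENNReal.ofReal r.conjExponent := by
  have hr' : 0 < r - 1 := sub_pos.2 hr
  rw [ENNReal.conjExponent, ← ENNReal.ofReal_one, ← ENNReal.ofReal_sub _ zero_le_one,
    ← ENNReal.ofReal_inv_of_pos hr', ← ENNReal.ofReal_add zero_le_one (inv_nonneg.2 hr'.le),
    Real.conjExponent]
  congr 1
  field_simp
  ring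

/-- For `m ≥ 2`, `p ≤ m'` says exactly that `p' ≥ m`, the order of means required. The case `p = 1`
is separate because `p'` is then infinite, and degrees `m ≤ 1`, where `m' = ∞`, are trivial. -/
theorem polarizationConst_Lp_le_of_le_conjExponent
    (hp : p ≤ ENNReal.conjExponent ((∑ j, k j : ℕ) : ℝ≥0∞)) :
    polarizationConst k (Lp ℂ p μ) ≤ ENNReal.ofReal (polarizationBound k p) := by
  rcases Nat.lt_or_ge 1 (∑ j, k j) with hm | hm
  swap
  · exact polarizationConst_Lp_le_of_sum_le_one μ k hm p
  have hp1 : 1 ≤ p := Fact.out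
  rcases hp1.eq_or_lt with rfl | hp1
  · exact polarizationConst_le_one k
  have hm' : (1 : ℝ) < (∑ j, k j : ℕ) := by exact_mod_cast hm
  rw [← ENNReal.ofReal_natCast, conjExponent_ofReal hm'] at hp
  have hpt : p ≠ ∞ := ne_top_of_le_ne_top ENNReal.ofReal_ne_top hp
  have hm2 : (2 : ℝ) ≤ (∑ j, k j : ℕ) := by exact_mod_cast hm
  have hP1 : 1 < p.toReal := by
    rw [← ENNReal.toReal_one]
    exact (ENNReal.toReal_lt_toReal ENNReal.one_ne_top hpt).2 hp1
  have hple : p.toReal ≤ (∑ j, k j : ℕ) / ((∑ j, k j : ℕ) - 1) :=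
    ENNReal.toReal_le_of_le_ofReal (div_nonneg (by linarith) (by linarith)) hp
  have hconj := Real.HolderConjugate.conjExponent hP1
  have hmq : ((∑ j, k j : ℕ) : ℝ) ≤ p.toReal.conjExponent := by
    rw [Real.conjExponent, le_div_iff₀ (by linarith)]
    rw [le_div_iff₀ (by linarith)] at hple
    linarith
  have h := polarizationConst_le_of_sum_norm_rpow_le (X := Lp ℂ p μ) k hconj.pos hmq fun x => by
    rw [card_torus]
    exact sum_norm_sum_phase_smul_rpow_le_of_le_two (Nat.succ_lt_succ (by omega)) hpt hconj
      (hm2.trans hmq) x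
  rwa [ENNReal.ofReal_toReal hpt] at h

/-- For `2 ≤ m ≤ p < ∞` the type `p'` inequality has means of order `p ≥ m`; `p = ∞` falls back on
the triangle inequality. -/
theorem polarizationConst_Lp_le_of_ge (hp : ((∑ j, k j : ℕ) : ℝ≥0∞) ≤ p) :
    polarizationConst k (Lp ℂ p μ) ≤
      ENNReal.ofReal (polarizationBound k (ENNReal.conjExponent p)) := by
  rcases Nat.lt_or_ge 1 (∑ j, k j) with hm | hm
  swap
  · exact polarizationConst_Lp_le_of_sum_le_one μ k hm _
  rcases eq_or_ne p ∞ with rfl | hpt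
  · have h1 : ENNReal.conjExponent ∞ = 1 := by simp [ENNReal.conjExponent]
    rw [h1]
    exact polarizationConst_le_one k
  have hmP : ((∑ j, k j : ℕ) : ℝ) ≤ p.toReal := by
    rw [← ENNReal.toReal_natCast]
    exact ENNReal.toReal_mono hpt hp
  have hm2 : (2 : ℝ) ≤ (∑ j, k j : ℕ) := by exact_mod_cast hm
  have hP1 : 1 < p.toReal := by linarith
  have hconj := (Real.HolderConjugate.conjExponent hP1).symm
  have h := polarizationConst_le_of_sum_norm_rpow_le (X := Lp ℂ p μ) k hconj.pos hmP fun x => by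
    rw [card_torus]
    exact sum_norm_sum_phase_smul_rpow_le_of_two_le (Nat.succ_lt_succ (by omega)) hpt
      (hm2.trans hmP) hconj x
  have hq : ENNReal.conjExponent p = ENNReal.ofReal p.toReal.conjExponent := by
    rw [← conjExponent_ofReal hP1, ENNReal.ofReal_toReal hpt]
  rwa [hq]

end UpperBound

/-! ### The product form on `ℓ^p` -/

/-- The complex sequence space `ℓ^p`. -/
abbrev SeqLp (p : ℝ≥0∞) : Type :=
  Lp ℂ p (Measure.count : Measure ℕ)

section Sequences

variable {p : ℝ≥0∞} [Fact (1 ≤ p)]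

theorem norm_apply_le_norm (u : SeqLp p) (i : ℕ) : ‖u i‖ ≤ ‖u‖ := by
  rw [Lp.norm_def, ← toReal_enorm]
  exact ENNReal.toReal_mono (Lp.eLpNorm_ne_top u)
    (enorm_le_eLpNorm_count _ i (one_pos.trans_le (Fact.out : 1 ≤ p)).ne')

/-- Evaluation of a sequence at an index. -/
noncomputable def coordCLM (p : ℝ≥0∞) [Fact (1 ≤ p)] (i : ℕ) : SeqLp p →L[ℂ] ℂ :=
  LinearMap.mkContinuous
    { toFun := fun u => u i
      -- Counting measure has no nonempty null sets, so almost everywhere identities hold at every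
      -- index.
      map_add' := fun u v => Measure.ae_count_iff.1 (Lp.coeFn_add u v) i
      map_smul' := fun c u => Measure.ae_count_iff.1 (Lp.coeFn_smul c u) i } 1
    fun u => by simpa using norm_apply_le_norm u i

@[simp]
theorem coordCLM_apply (i : ℕ) (u : SeqLp p) : coordCLM p i u = u i :=
  rfl

/-- The symmetric form `L` with `L (u, …, u) = u₁ ⋯ uₘ`. -/
noncomputable def productForm (p : ℝ≥0∞) [Fact (1 ≤ p)] (m : ℕ) :
    ContinuousMultilinearMap ℂ (fun _ : Fin m => SeqLp p) ℂ :=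
  (m ! : ℂ)⁻¹ • ∑ σ : Equiv.Perm (Fin m),
    (ContinuousMultilinearMap.mkPiAlgebra ℂ (Fin m) ℂ).compContinuousLinearMap
      fun i => coordCLM p (σ i : Fin m)

theorem productForm_apply (m : ℕ) (x : Fin m → SeqLp p) :
    productForm p m x = (m ! : ℂ)⁻¹ * ∑ σ : Equiv.Perm (Fin m), ∏ i, x i (σ i : Fin m) := by
  simp [productForm]

theorem isSymmetricForm_productForm (m : ℕ) : IsSymmetricForm (productForm p m) := by
  intro τ x
  rw [productForm_apply, productForm_apply]
  congr 1
  refine Fintype.sum_equiv (Equiv.mulRight τ⁻¹) _ _ fun σ => ?_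
  refine Fintype.prod_equiv τ _ _ fun i => ?_
  simp

theorem assocPoly_productForm (m : ℕ) (u : SeqLp p) :
    assocPoly (productForm p m) u = ∏ i ∈ Finset.range m, u i := by
  have h : ∀ σ : Equiv.Perm (Fin m), ∏ i, u (σ i : Fin m) = ∏ i ∈ Finset.range m, u i := by
    intro σ
    rw [Equiv.prod_comp σ fun i : Fin m => u i, Fin.prod_univ_eq_prod_range (fun i => u i) m]
  rw [assocPoly, productForm_apply]
  simp_rw [h]
  rw [Finset.sum_const, Finset.card_univ, Fintype.card_perm, Fintype.card_fin, nsmul_eq_mul,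
    inv_mul_cancel_left₀ (Nat.cast_ne_zero.2 (Nat.factorial_ne_zero m))]

theorem sum_norm_rpow_le_norm_rpow (hp : p ≠ ∞) (u : SeqLp p) (s : Finset ℕ) :
    ∑ i ∈ s, ‖u i‖ ^ p.toReal ≤ ‖u‖ ^ p.toReal := by
  have hint := Lp_integrable_norm_rpow_toReal hp u
  rw [Lp_norm_rpow_toReal hp, integral_countable hint]
  simp only [measureReal_def, Measure.count_singleton, ENNReal.toReal_one, one_smul]
  exact (integrable_count_iff.1 hint).of_norm.sum_le_tsum s fun i _ => by positivity

/-- On the unit ball of `ℓ^p`, a product of `m` coordinates is at most `m ^ (-m / p)`. -/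
theorem norm_prod_range_le (m : ℕ) {u : SeqLp p} (hu : ‖u‖ ≤ 1) :
    ‖∏ i ∈ Finset.range m, u i‖ ≤ (((m : ℝ) ^ m) ^ (1 / p).toReal)⁻¹ := by
  rw [norm_prod]
  have hp1 : 1 ≤ p := Fact.out
  rcases eq_or_ne p ∞ with rfl | hp
  · simpa using Finset.prod_le_one (fun _ _ => norm_nonneg _)
      fun i _ => (norm_apply_le_norm u i).trans hu
  rcases Nat.eq_zero_or_pos m with rfl | hm
  · simp
  have hP : 0 < p.toReal := ENNReal.toReal_pos (one_pos.trans_le hp1).ne' hp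
  have hm' : (0 : ℝ) < m := Nat.cast_pos.2 hm
  have hs : ∑ i ∈ Finset.range m, ‖u i‖ ^ p.toReal ≤ 1 :=
    (sum_norm_rpow_le_norm_rpow hp u _).trans (Real.rpow_le_one (norm_nonneg _) hu hP.le)
  -- AM–GM for the numbers `‖u i‖ ^ p`, whose sum is at most `1`.
  have hamgm := Real.geom_mean_le_arith_mean (Finset.range m) (fun _ => 1)
    (fun i => ‖u i‖ ^ p.toReal) (fun _ _ => zero_le_one) (by simpa using hm)
    fun i _ => by positivity
  simp only [Real.rpow_one, one_mul, Finset.sum_const, Finset.card_range, nsmul_eq_mul, mul_one]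
    at hamgm
  rw [Real.finsetProd_rpow _ _ fun i _ => norm_nonneg _] at hamgm
  set A := ∏ i ∈ Finset.range m, ‖u i‖ with hA
  have hA0 : 0 ≤ A := Finset.prod_nonneg fun i _ => norm_nonneg _
  have h1 : (A ^ p.toReal) ^ (m : ℝ)⁻¹ ≤ (m : ℝ)⁻¹ := by
    refine hamgm.trans ?_
    rw [div_eq_mul_inv]
    exact mul_le_of_le_one_left (by positivity) hs
  have h2 := pow_le_pow_left₀ (by positivity) h1 m
  rw [Real.rpow_inv_natCast_pow (by positivity) hm.ne', inv_pow] at h2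
  have h3 := Real.rpow_le_rpow (by positivity) h2 (one_div_nonneg.2 hP.le)
  rw [← Real.rpow_mul hA0, mul_one_div_cancel hP.ne', Real.rpow_one,
    Real.inv_rpow (by positivity)] at h3
  rwa [ENNReal.toReal_div, ENNReal.toReal_one]

/-- The unit vector of `ℓ^p` that is constant on the finite set `B` and vanishes elsewhere. -/
noncomputable def flatVector (p : ℝ≥0∞) [Fact (1 ≤ p)] (B : Finset ℕ) : SeqLp p :=
  indicatorConstLp p B.measurableSet (μ := Measure.count) (by simp)
    ((((B.card : ℝ) ^ (1 / p).toReal)⁻¹ : ℝ) : ℂ)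

theorem norm_flatVector {B : Finset ℕ} (hB : B.Nonempty) : ‖flatVector p B‖ = 1 := by
  have hc : (0 : ℝ) < B.card := Nat.cast_pos.2 hB.card_pos
  rw [flatVector, norm_indicatorConstLp' (one_pos.trans_le (Fact.out : 1 ≤ p)).ne'
    (by simpa using hB.card_pos.ne'), Complex.norm_real, Real.norm_of_nonneg (by positivity),
    measureReal_def, Measure.count_apply_finset, ENNReal.toReal_natCast, ENNReal.toReal_div,
    ENNReal.toReal_one, inv_mul_cancel₀ (by positivity)]

theorem flatVector_apply (B : Finset ℕ) (i : ℕ) :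
    flatVector p B i = if i ∈ B then ((((B.card : ℝ) ^ (1 / p).toReal)⁻¹ : ℝ) : ℂ) else 0 := by
  have h := Measure.ae_count_iff.1 (indicatorConstLp_coeFn (p := p) (hs := B.measurableSet)
    (μ := Measure.count) (hμs := by simp)
    (c := ((((B.card : ℝ) ^ (1 / p).toReal)⁻¹ : ℝ) : ℂ))) i
  rw [flatVector, h]
  simp [Set.indicator_apply]

end Sequences

/-! ### Flat vectors on blocks and sharpness of the estimate -/

section Extremal

variable {n : ℕ} (k : Fin n → ℕ)

/-- The `j`-th block of consecutive integers, or `{0}` if that block is empty. -/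
def blockSupport (j : Fin n) : Finset ℕ :=
  -- An empty block contributes no argument to the form, so its vector only has to have norm `1`.
  if k j = 0 then {0} else (Finset.univ.filter fun i => blockIndex k i = j).map Fin.valEmbedding

theorem card_filter_blockIndex (j : Fin n) :
    (Finset.univ.filter fun i => blockIndex k i = j).card = k j := by
  rw [← Fintype.card_subtype, card_blockIndex_eq]

theorem blockSupport_nonempty (j : Fin n) : (blockSupport k j).Nonempty := by
  unfold blockSupport
  split_ifs with h
  · exact Finset.singleton_nonempty 0
  · rw [Finset.map_nonempty, ← Finset.card_pos, card_filter_blockIndex]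
    exact Nat.pos_of_ne_zero h

theorem card_blockSupport {j : Fin n} (hj : k j ≠ 0) : (blockSupport k j).card = k j := by
  rw [blockSupport, if_neg hj, Finset.card_map, card_filter_blockIndex]

theorem mem_blockSupport {j : Fin n} (hj : k j ≠ 0) (i : Fin (∑ j, k j)) :
    (i : ℕ) ∈ blockSupport k j ↔ blockIndex k i = j := by
  rw [blockSupport, if_neg hj, Finset.mem_map]
  constructor
  · rintro ⟨i', hi', h⟩
    rw [← Fin.ext (show (i' : ℕ) = i from h)]
    exact (Finset.mem_filter.1 hi').2
  · exact fun h => ⟨i, Finset.mem_filter.2 ⟨Finset.mem_univ _, h⟩, rfl⟩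

theorem blockIndex_ne_zero (i : Fin (∑ j, k j)) : k (blockIndex k i) ≠ 0 := by
  rw [← card_blockIndex_eq k]
  exact (Fintype.card_pos_iff.2 ⟨⟨i, rfl⟩⟩).ne'

variable {p : ℝ≥0∞} [Fact (1 ≤ p)]

/-- The supports are the blocks themselves, so a permutation contributes only if it preserves every
block. There are `∏ (k j)!` of these, all giving the same product. -/
theorem evalBlocks_productForm_flatVector :
    evalBlocks k (productForm p (∑ j, k j)) (fun j => flatVector p (blockSupport k j)) =
      (((∏ j, ((k j)! : ℝ)) / ((∑ j, k j)! : ℝ) *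
        ((∏ j, (k j : ℝ) ^ k j) ^ (1 / p).toReal)⁻¹ : ℝ) : ℂ) := by
  set s := (1 / p).toReal with hs
  have hpow : ∏ j, (((k j : ℝ) ^ s)⁻¹) ^ k j = ((∏ j, (k j : ℝ) ^ k j) ^ s)⁻¹ := by
    rw [← Real.finsetProd_rpow _ _ fun j _ => by positivity, ← Finset.prod_inv_distrib]
    refine Finset.prod_congr rfl fun j _ => ?_
    rw [inv_pow, ← Real.rpow_mul_natCast (by positivity), mul_comm,
      Real.rpow_natCast_mul (by positivity)]
  have hterm : ∀ σ : Equiv.Perm (Fin (∑ j, k j)),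
      ∏ i, flatVector p (blockSupport k (blockIndex k i)) (σ i : Fin (∑ j, k j)) =
        if blockIndex k ∘ σ = blockIndex k then
          ((((∏ j, (k j : ℝ) ^ k j) ^ s)⁻¹ : ℝ) : ℂ) else 0 := fun σ => by
    simp_rw [flatVector_apply, mem_blockSupport k (blockIndex_ne_zero k _),
      card_blockSupport k (blockIndex_ne_zero k _), ← hs]
    split_ifs with h
    · rw [Finset.prod_congr rfl fun i _ => if_pos (show blockIndex k (σ i) = _ from congrFun h i),
        prod_comp_eq_prod_pow_card (blockIndex k) fun j => ((((k j : ℝ) ^ s)⁻¹ : ℝ) : ℂ),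
        ← hpow]
      simp_rw [card_blockIndex_eq]
      push_cast
      rfl
    · obtain ⟨i, hi⟩ := Function.ne_iff.1 h
      exact Finset.prod_eq_zero (Finset.mem_univ i) (if_neg hi)
  have hcard : (Finset.univ.filter fun σ : Equiv.Perm (Fin (∑ j, k j)) =>
      blockIndex k ∘ σ = blockIndex k).card = ∏ j, (k j)! := by
    rw [← Fintype.card_subtype, DomMulAct.stabilizer_card]
    simp_rw [card_blockIndex_eq]
  rw [evalBlocks_eq, productForm_apply]
  simp only [Function.comp_apply]
  rw [Finset.sum_congr rfl fun σ _ => hterm σ, ← Finset.sum_filter, Finset.sum_const, hcard,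
    nsmul_eq_mul]
  push_cast
  ring

/-- Values of a symmetric form on the unit ball bound the polarization constant from below. -/
theorem ofReal_div_le_polarizationConst {X : Type*} [NormedAddCommGroup X] [NormedSpace ℂ X]
    {k : Fin n → ℕ} {L : ContinuousMultilinearMap ℂ (fun _ : Fin (∑ j, k j) => X) ℂ}
    (hL : IsSymmetricForm L) {x : Fin n → X} (hx : ∀ j, ‖x j‖ ≤ 1) :
    ENNReal.ofReal (‖evalBlocks k L x‖ / polyNorm L) ≤ polarizationConst k X := by
  refine le_iInf₂ fun M hM => ?_
  refine ENNReal.ofReal_le_of_le_toReal ?_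
  rw [ENNReal.coe_toReal]
  have h : ‖evalBlocks k L x‖ ≤ blockNorm k L :=
    le_ciSup (bddAbove_blockNorm k L)
      (fun j => (⟨x j, mem_closedBall_zero_iff.2 (hx j)⟩ : Metric.closedBall (0 : X) 1))
  exact div_le_of_le_mul₀ (polyNorm_nonneg L) M.2 (h.trans (hM.2 L hL))

/-- If the polarization constant is finite, then `polyNorm` vanishes on no symmetric form with a
nonzero value. -/
theorem polyNorm_pos_of_evalBlocks_ne_zero {X : Type*} [NormedAddCommGroup X] [NormedSpace ℂ X]
    {k : Fin n → ℕ} (hX : polarizationConst k X < ∞)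
    {L : ContinuousMultilinearMap ℂ (fun _ : Fin (∑ j, k j) => X) ℂ}
    (hL : IsSymmetricForm L) {x : Fin n → X} (hx : ∀ j, ‖x j‖ ≤ 1) (h0 : evalBlocks k L x ≠ 0) :
    0 < polyNorm L := by
  obtain ⟨M, hM⟩ := iInf_lt_iff.1 hX
  obtain ⟨hM, -⟩ := iInf_lt_iff.1 hM
  have h : ‖evalBlocks k L x‖ ≤ blockNorm k L :=
    le_ciSup (bddAbove_blockNorm k L)
      (fun j => (⟨x j, mem_closedBall_zero_iff.2 (hx j)⟩ : Metric.closedBall (0 : X) 1))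
  exact pos_of_mul_pos_right ((norm_pos_iff.2 h0).trans_le (h.trans (hM.2 L hL))) M.2

theorem polyNorm_productForm_le (m : ℕ) :
    polyNorm (productForm p m) ≤ (((m : ℝ) ^ m) ^ (1 / p).toReal)⁻¹ := by
  have : Nonempty (Metric.closedBall (0 : SeqLp p) 1) := ⟨⟨0, by simp⟩⟩
  refine ciSup_le fun u => ?_
  rw [assocPoly_productForm]
  exact norm_prod_range_le m (mem_closedBall_zero_iff.1 u.2)

/-- The factor `m ^ m` comes from AM–GM, the remaining factors from the flat vectors. -/
theorem polarizationBound_mul_polyNorm_productForm_le :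
    polarizationBound k p * polyNorm (productForm p (∑ j, k j)) ≤
      ‖evalBlocks k (productForm p (∑ j, k j)) fun j => flatVector p (blockSupport k j)‖ := by
  refine (mul_le_mul_of_nonneg_left (polyNorm_productForm_le _)
    (polarizationBound_pos k p).le).trans ?_
  have hP := prod_pow_self_pos k
  have hm : (0 : ℝ) < ((∑ j, k j : ℕ) : ℝ) ^ (∑ j, k j) := mod_cast Nat.pow_self_pos
  rw [evalBlocks_productForm_flatVector, Complex.norm_real, Real.norm_of_nonneg (by positivity),
    polarizationBound, Real.div_rpow hm.le hP.le]
  have h1 := Real.rpow_pos_of_pos hm (1 / p).toReal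
  refine le_of_eq ?_
  field_simp

/-- A sandwich: the upper estimate on `ℓ^p` and the quotient computed from the flat vectors force
equality. The norm of the product polynomial is thus needed only from above. -/
theorem productForm_extremal (hp : p ≤ ENNReal.conjExponent ((∑ j, k j : ℕ) : ℝ≥0∞)) :
    polarizationConst k (SeqLp p) = ENNReal.ofReal (polarizationBound k p) ∧
      0 < polyNorm (productForm p (∑ j, k j)) ∧
      ‖evalBlocks k (productForm p (∑ j, k j)) fun j => flatVector p (blockSupport k j)‖ =
        polarizationBound k p * polyNorm (productForm p (∑ j, k j)) := by
  have hle : polarizationConst k (SeqLp p) ≤ ENNReal.ofReal (polarizationBound k p) :=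
    polarizationConst_Lp_le_of_le_conjExponent _ k hp
  have hsymm := isSymmetricForm_productForm (p := p) (∑ j, k j)
  have hunit : ∀ j, ‖flatVector p (blockSupport k j)‖ ≤ 1 := fun j =>
    (norm_flatVector (blockSupport_nonempty k j)).le
  have hpos : 0 < polyNorm (productForm p (∑ j, k j)) := by
    -- Positivity comes from the upper estimate: with a finite constant, a form that is nonzero
    -- somewhere has a nonzero polynomial.
    refine polyNorm_pos_of_evalBlocks_ne_zero (hle.trans_lt ENNReal.ofReal_lt_top) hsymm hunit ?_
    have hP := prod_pow_self_pos k
    have hF : (0 : ℝ) < ∏ j, ((k j)! : ℝ) :=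
      Finset.prod_pos fun j _ => Nat.cast_pos.2 (Nat.factorial_pos _)
    rw [evalBlocks_productForm_flatVector]
    exact Complex.ofReal_ne_zero.2 (by positivity)
  have hge := ofReal_div_le_polarizationConst hsymm hunit
  have hlow := polarizationBound_mul_polyNorm_productForm_le (p := p) k
  refine ⟨hle.antisymm (le_trans (ENNReal.ofReal_le_ofReal ?_) hge), hpos, hlow.antisymm' ?_⟩
  · exact (le_div_iff₀ hpos).2 hlow
  · rw [← div_le_iff₀ hpos]
    exact (ENNReal.ofReal_le_ofReal_iff (polarizationBound_pos k p).le).1 (hge.trans hle)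

end Extremal

theorem theorem3p2 {n : ℕ} (k : Fin n → ℕ) (m : ℕ) (hm : ∑ j, k j = m)
    (p : ℝ≥0∞) [Fact (1 ≤ p)] :
    -- the estimate for `1 ≤ p ≤ m'`
    (p ≤ ENNReal.conjExponent (m : ℝ≥0∞) →
      ∀ (Ω : Type*) [MeasurableSpace Ω] (μ : Measure Ω),
        polarizationConst k (Lp ℂ p μ) ≤ ENNReal.ofReal (polarizationBound k p)) ∧
    -- the estimate for `m ≤ p ≤ ∞`
    ((m : ℝ≥0∞) ≤ p →
      ∀ (Ω : Type*) [MeasurableSpace Ω] (μ : Measure Ω),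
        polarizationConst k (Lp ℂ p μ) ≤
          ENNReal.ofReal (polarizationBound k (ENNReal.conjExponent p))) ∧
    -- for `1 ≤ p ≤ m'` the estimate is an equality on `ℓ^p`, attained by the product form
    (p ≤ ENNReal.conjExponent (m : ℝ≥0∞) →
      polarizationConst k (Lp ℂ p (Measure.count : Measure ℕ)) =
        ENNReal.ofReal (polarizationBound k p) ∧
      ∃ L : ContinuousMultilinearMap ℂ
          (fun _ : Fin (∑ j, k j) => Lp ℂ p (Measure.count : Measure ℕ)) ℂ,
        IsSymmetricForm L ∧
        (∀ u : Lp ℂ p (Measure.count : Measure ℕ), assocPoly L u = ∏ i ∈ Finset.range m, u i) ∧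
        0 < polyNorm L ∧
        ∃ y : Fin n → Lp ℂ p (Measure.count : Measure ℕ),
          (∀ j, ‖y j‖ = 1) ∧
          ‖evalBlocks k L y‖ = polarizationBound k p * polyNorm L) := by
  subst hm
  refine ⟨fun hp Ω _ μ => polarizationConst_Lp_le_of_le_conjExponent μ k hp,
    fun hp Ω _ μ => polarizationConst_Lp_le_of_ge μ k hp, fun hp => ?_⟩
  obtain ⟨hconst, hpos, hval⟩ := productForm_extremal k hp
  exact ⟨hconst, productForm p (∑ j, k j), isSymmetricForm_productForm _,
    assocPoly_productForm _, hpos, fun j => flatVector p (blockSupport k j),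
    fun j => norm_flatVector (blockSupport_nonempty k j), hval⟩
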